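/- Let $n,d\ge 1$ be integers, let $\mathcal G$ be an undirected connected (simple) graph on $\{1,\dots,n\}$ with Laplacian $L$ and neighbor sets $\mathcal N_i$, and let $S_1,\dots,S_n\in\mathbb R^{d\times d}$ be matrices, not necessarily symmetric, each of which is positive definite ($x^\top S_i x>0$ for all $x\ne 0$) or negative definite ($x^\top S_i x<0$ for all $x\neq 0$). For a positive (resp. negative) definite matrix $A$ put $\operatorname{sign}(A)=1$ (resp. $-1$) and $|A|=\operatorname{sign}(A)A$. Let $\alpha>0$ and consider the double-integrator agents $$\dot x_i^1=x_i^2,\qquad \dot x_i^2=-\operatorname{sign}(S_i)\sum_{j\in\mathcal N_i}(S_ix_i^1-S_jx_j^1)-\alpha x_i^2,\qquad x_i^1,x_i^2\in\mathbb R^d,\quad i=1,\dots,n,\ t\ge 0 .$$ Let $\Theta=\operatorname{blkdiag}(|S_1|,\dots,|S_n|)(L\otimes I_d)$ and suppose that $$\min_{\mu}\operatorname{Re}(\mu)>\frac{\bigl(\max_{\mu}\operatorname{Im}(\mu)\bigr)^2}{\alpha^2},$$ where the minimum and the maximum are taken over the nonzero complex eigenvalues $\mu$ of $\Theta$ (the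 condition is void if there are none). Then every solution $(x^1(t),x^2(t))$ on $[0,\infty)$ converges, as $t\to+\infty$, to a point of $$\mathcal A'=\{(x^1,x^2): S_1x_1^1=S_2x_2^1=\dots=S_nx_n^1,\ x^2=0\}.$$ Moreover, for every $i$, $\lim_{t\to+\infty}S_ix_i^1(t)=x^{a1}+\alpha^{-1}x^{a2}$ and $\lim_{t\to+\infty}x_i^2(t)=0$, where $$x^{al}=\Bigl(\sum_{i=1}^n|S_i^{-1}|\Bigr)^{-1}\sum_{i=1}^n\operatorname{sign}(S_i)\,x_i^l(0),\qquad l=1,2 .$$ -/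

import Mathlib

open Filter Topology Set
open scoped Matrix Kronecker

noncomputable section

namespace MSC

/-- Positive definiteness of a real square matrix that need not be symmetric. -/
def IsPosDef {d : ℕ} (A : Matrix (Fin d) (Fin d) ℝ) : Prop :=
  ∀ x : Fin d → ℝ, x ≠ 0 → 0 < x ⬝ᵥ (A *ᵥ x)

/-- Negative definiteness of a real square matrix that need not be symmetric. -/
def IsNegDef {d : ℕ} (A : Matrix (Fin d) (Fin d) ℝ) : Prop :=
  ∀ x : Fin d → ℝ, x ≠ 0 → x ⬝ᵥ (A *ᵥ x) < 0

open Classical in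
/-- The sign of a definite matrix: `1` if it is positive definite, `-1` if it is negative definite
(and `0` for matrices that are neither, which are never used as scaling matrices). -/
def matSign {d : ℕ} (A : Matrix (Fin d) (Fin d) ℝ) : ℝ :=
  if IsPosDef A then 1 else if IsNegDef A then -1 else 0

/-- `|A| = sign(A) A`. -/
def matAbs {d : ℕ} (A : Matrix (Fin d) (Fin d) ℝ) : Matrix (Fin d) (Fin d) ℝ :=
  matSign A • A

/-- The block diagonal matrix with blocks `M 0, …, M (n-1)`; rows and columns are indexed by
pairs (agent, coordinate). -/
def blkdiag {n d : ℕ} (M : Fin n → Matrix (Fin d) (Fin d) ℝ) :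
    Matrix (Fin n × Fin d) (Fin n × Fin d) ℝ :=
  Matrix.of fun p q => if p.1 = q.1 then M p.1 p.2 q.2 else 0

/-- The scaled Laplacian `Θ = |S| (L ⊗ I_d)`. -/
def scaledLaplacian {n d : ℕ} (G : SimpleGraph (Fin n)) [DecidableRel G.Adj]
    (S : Fin n → Matrix (Fin d) (Fin d) ℝ) : Matrix (Fin n × Fin d) (Fin n × Fin d) ℝ :=
  blkdiag (fun i => matAbs (S i)) * (G.lapMatrix ℝ ⊗ₖ (1 : Matrix (Fin d) (Fin d) ℝ))

/-- The nonzero complex eigenvalues of the scaled Laplacian. -/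
def nonzeroEigenvalues {n d : ℕ} (G : SimpleGraph (Fin n)) [DecidableRel G.Adj]
    (S : Fin n → Matrix (Fin d) (Fin d) ℝ) : Set ℂ :=
  {μ | μ ∈ spectrum ℂ ((scaledLaplacian G S).map Complex.ofReal) ∧ μ ≠ 0}

/-- The condition `min Re μ_k > (max Im μ_k)² / α²`, where the minimum and the maximum run over the
nonzero eigenvalues of the scaled Laplacian. The set of these eigenvalues is finite, so both
extrema exist unless it is empty (a single agent), in which case there is no condition. -/
def DampingCondition {n d : ℕ} (G : SimpleGraph (Fin n)) [DecidableRel G.Adj]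
    (S : Fin n → Matrix (Fin d) (Fin d) ℝ) (α : ℝ) : Prop :=
  ∀ m M : ℝ, IsLeast (Complex.re '' nonzeroEigenvalues G S) m →
    IsGreatest (Complex.im '' nonzeroEigenvalues G S) M → M ^ 2 / α ^ 2 < m

/-- The consensus law `u_i = -sign(S_i) ∑_{j ∈ N_i} (S_i x_i¹ - S_j x_j¹) - α x_i²`. -/
def consensusLaw {n d : ℕ} (G : SimpleGraph (Fin n)) [DecidableRel G.Adj]
    (S : Fin n → Matrix (Fin d) (Fin d) ℝ) (α : ℝ) (x1 x2 : Fin n → Fin d → ℝ) (i : Fin n) :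
    Fin d → ℝ :=
  -(matSign (S i) • ∑ j ∈ G.neighborFinset i, (S i *ᵥ x1 i - S j *ᵥ x1 j)) - α • x2 i

/-- `(x1, x2)` is a trajectory on `[0, ∞)` of the double integrators `ẋ_i¹ = x_i²`, `ẋ_i² = u_i`
under the consensus law. The derivative at time `0` is one-sided. -/
def IsTrajectory {n d : ℕ} (G : SimpleGraph (Fin n)) [DecidableRel G.Adj]
    (S : Fin n → Matrix (Fin d) (Fin d) ℝ) (α : ℝ) (x1 x2 : ℝ → Fin n → Fin d → ℝ) : Prop :=
  ∀ i : Fin n, ∀ t : ℝ, 0 ≤ t →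
    HasDerivWithinAt (fun s => x1 s i) (x2 t i) (Ici 0) t ∧
    HasDerivWithinAt (fun s => x2 s i) (consensusLaw G S α (x1 t) (x2 t) i) (Ici 0) t

/-- The set `𝒜'` of states `(x¹, x²)` with `S_1 x_1¹ = … = S_n x_n¹` and `x² = 0`. -/
def consensusSet {n d : ℕ} (S : Fin n → Matrix (Fin d) (Fin d) ℝ) :
    Set ((Fin n → Fin d → ℝ) × (Fin n → Fin d → ℝ)) :=
  {x | (∀ i j, S i *ᵥ x.1 i = S j *ᵥ x.1 j) ∧ x.2 = 0}

/-- `(∑ |S_i⁻¹|)⁻¹ ∑ sign(S_i) y_i`. -/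
def virtualPoint {n d : ℕ} (S : Fin n → Matrix (Fin d) (Fin d) ℝ) (y : Fin n → Fin d → ℝ) :
    Fin d → ℝ :=
  (∑ i, matAbs (S i)⁻¹)⁻¹ *ᵥ ∑ i, matSign (S i) • y i

end MSC

end

/-!
In the coordinates `y_i = S_i x_i¹` a trajectory solves `y'' + α y' + Θ y = 0` with
`Θ = D K`, where `D = blkdiag |S_i|` is positive definite (not necessarily symmetric) and
`K = L ⊗ I` is symmetric. For an eigenvalue `μ ≠ 0` of `Θ` the damping condition says that both
roots of `z² + α z + μ` lie in the open left half-plane (`DampingCondition.im_sq_lt`,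
`exists_stable_roots`).

The eigenvalue `0` is semisimple: `D K D K v = 0` gives `(K v) ⬝ D (K v) = 0`, so `K v = 0`
(`scaledLaplacian_mulVec_eq_zero_of_sq`). Hence `q(Θ) Θ = 0` for a polynomial `q` whose roots are
nonzero eigenvalues, and `w = Θ y` is a solution with `q(Θ) w = 0`. No matrix exponential or Jordan
form is needed to conclude that `w → 0`: if `(Θ - μ) w → 0`, then `w'' + α w' + μ w → 0`, which
factors into two stable first-order equations with vanishing input
(`tendsto_zero_of_hasDerivAt_smul_add`), so `w → 0`; since `(Θ - μ) w` is again a solution, the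
factors of `q` can be removed one at a time (`IsDampedSolution.tendsto_zero_of_aeval`). From
`Θ y → 0` it follows that `y' → 0` and, the kernel of `Θ` being the consensus space of the connected
graph, that `y_i - y_j → 0`.

The limit is found from the conserved quantity `∑ sign(S_i) (α x_i¹ + x_i²)`
(`IsTrajectory.sum_matSign_smul_eq`): up to vanishing terms it equals `α (∑ |S_j⁻¹|) y_i`, and
`∑ |S_j⁻¹|` is positive definite, hence invertible.
-/

namespace MSC

/-! ### Decay for linear differential equations with a vanishing input -/

section Decay

variable {E : Type*} [NormedAddCommGroup E] [NormedSpace ℂ E]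

/-- A stable first-order equation `v' = l v + f` driven by an input `f → 0` has `v → 0`. -/
lemma tendsto_zero_of_hasDerivAt_smul_add {l : ℂ} (hl : l.re < 0) {v f : ℝ → E}
    (hv : ∀ t, 0 < t → HasDerivAt v (l • v t + f t) t)
    (hf : Tendsto f atTop (𝓝 0)) : Tendsto v atTop (𝓝 0) := by
  obtain ⟨a, ha, hal⟩ : ∃ a : ℝ, 0 < a ∧ l.re = -a := ⟨-l.re, by linarith, by ring⟩
  rw [Metric.tendsto_atTop]
  intro ε hε
  obtain ⟨T₀, hT₀⟩ := Metric.tendsto_atTop.1 hf (a * (ε / 2)) (by positivity)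
  set T := max T₀ 1
  have hTpos : 0 < T := lt_of_lt_of_le one_pos (le_max_right _ _)
  -- The integrating factor `exp (-l t)` turns the equation into `g' = exp (-l t) f`.
  set g : ℝ → E := fun t => Complex.exp (-l * t) • v t with hg
  have hexp : ∀ t : ℝ, ‖Complex.exp (-l * t)‖ = Real.exp (a * t) := by
    intro t
    rw [Complex.norm_exp]
    congr 1
    simp [hal]
  have hgd : ∀ t : ℝ, 0 < t → HasDerivAt g (Complex.exp (-l * t) • f t) t := by
    intro t ht
    have h1 : HasDerivAt (fun s : ℝ => Complex.exp (-l * s)) (Complex.exp (-l * t) * -l) t := by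
      have h0 : HasDerivAt (fun s : ℝ => -l * (s : ℂ)) (-l) t := by
        simpa using (Complex.ofRealCLM.hasDerivAt (x := t)).const_mul (-l)
      exact h0.cexp
    have h2 := h1.smul (hv t ht)
    refine h2.congr_deriv ?_
    rw [smul_add, smul_smul, add_right_comm, ← add_smul]
    simp
  -- For `t ≥ T` the right side grows at most like the derivative of `ε / 2 * exp (a t)`.
  have hbound : ∀ t, T ≤ t → ‖g t‖ ≤ ‖g T‖ + ε / 2 * Real.exp (a * t) := by
    intro t ht
    refine image_norm_le_of_norm_deriv_right_le_deriv_boundary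
      (f' := fun s => Complex.exp (-l * s) • f s)
      (B := fun s => ‖g T‖ + ε / 2 * Real.exp (a * s))
      (B' := fun s => ε / 2 * (Real.exp (a * s) * a)) (a := T) (b := t)
      ?_ ?_ ?_ ?_ ?_ (right_mem_Icc.2 ht)
    · intro s hs
      exact (hgd s (hTpos.trans_le hs.1)).continuousAt.continuousWithinAt
    · intro s hs
      exact (hgd s (hTpos.trans_le hs.1)).hasDerivWithinAt
    · have : 0 < Real.exp (a * T) := Real.exp_pos _
      have : 0 ≤ ε / 2 * Real.exp (a * T) := by positivity
      linarith
    · intro s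
      have h0 : HasDerivAt (fun s : ℝ => a * s) a s := by
        simpa using (hasDerivAt_id s).const_mul a
      exact (h0.exp.const_mul (ε / 2)).const_add _
    · intro s hs
      have h1 : ‖f s‖ < a * (ε / 2) := by
        simpa using hT₀ s ((le_max_left _ _).trans hs.1)
      rw [norm_smul, hexp]
      have h2 := mul_le_mul_of_nonneg_left h1.le (Real.exp_pos (a * s)).le
      linarith
  have hlim : Tendsto (fun t : ℝ => ‖g T‖ * Real.exp (-(a * t))) atTop (𝓝 0) := by
    have h1 : Tendsto (fun t : ℝ => a * t) atTop atTop := tendsto_id.const_mul_atTop ha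
    simpa using (Real.tendsto_exp_neg_atTop_nhds_zero.comp h1).const_mul ‖g T‖
  obtain ⟨T₁, hT₁⟩ := (Metric.tendsto_atTop.1 hlim) (ε / 2) (by positivity)
  refine ⟨max T T₁, fun t ht => ?_⟩
  have h1 := hbound t ((le_max_left _ _).trans ht)
  have h2 := hT₁ t ((le_max_right _ _).trans ht)
  rw [Real.dist_eq, sub_zero, abs_of_nonneg (by positivity)] at h2
  rw [dist_zero_right]
  have h3 : ‖g t‖ = Real.exp (a * t) * ‖v t‖ := by rw [hg, norm_smul, hexp]
  have h4 : ‖v t‖ = Real.exp (-(a * t)) * ‖g t‖ := by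
    rw [h3, ← mul_assoc, ← Real.exp_add]; simp
  have h5 : Real.exp (-(a * t)) * Real.exp (a * t) = 1 := by rw [← Real.exp_add]; simp
  have h6 := mul_le_mul_of_nonneg_left h1 (Real.exp_pos (-(a * t))).le
  rw [h4]
  nlinarith [h6, h5, h2]

/-- If `α² Re μ > (Im μ)²`, then `z² + α z + μ` has both roots in the open left half-plane. -/
lemma exists_stable_roots {α : ℝ} (hα : 0 < α) {μ : ℂ} (hμ : μ.im ^ 2 < α ^ 2 * μ.re) :
    ∃ l m : ℂ, l + m = -α ∧ l * m = μ ∧ l.re < 0 ∧ m.re < 0 := by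
  obtain ⟨s, hs⟩ := IsAlgClosed.exists_pow_nat_eq ((α : ℂ) ^ 2 - 4 * μ) (n := 2) (by norm_num)
  have hre := congrArg Complex.re hs
  have him := congrArg Complex.im hs
  simp [pow_two] at hre him
  have hlt : s.re ^ 2 < α ^ 2 := by
    by_contra! h
    have h1 : s.re ^ 2 * s.im ^ 2 = 4 * μ.im ^ 2 := by
      have h2 : s.re * s.im = -2 * μ.im := by linarith
      rw [← mul_pow, h2]; ring
    have h3 : s.im ^ 2 = s.re ^ 2 - α ^ 2 + 4 * μ.re := by linarith
    have h4 : 0 ≤ (s.re ^ 2 - α ^ 2) * s.im ^ 2 := mul_nonneg (by linarith) (sq_nonneg _)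
    have h5 : 0 ≤ (s.re ^ 2 - α ^ 2) * α ^ 2 := mul_nonneg (by linarith) (sq_nonneg _)
    rw [h3] at h1 h4
    nlinarith
  have habs := abs_lt.1 (abs_lt_of_sq_lt_sq hlt hα.le)
  refine ⟨(-α + s) / 2, (-α - s) / 2, by ring, ?_, ?_, ?_⟩
  · linear_combination (-1 / 4) * hs
  · simp; linarith
  · simp; linarith

/-- The pair `(w, v)` solves `w' = v`, `v' = -α v - T w` at positive times; the one-sided equation
at time `0` does not affect the limit. -/
def IsDampedSolution (T : E →L[ℂ] E) (α : ℝ) (w v : ℝ → E) : Prop :=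
  ∀ t, 0 < t → HasDerivAt w (v t) t ∧ HasDerivAt v (-(α : ℂ) • v t - T (w t)) t

/-- Operators commuting with `T` map solutions to solutions. -/
lemma IsDampedSolution.map {T : E →L[ℂ] E} {α : ℝ} {w v : ℝ → E}
    (h : IsDampedSolution T α w v) {Q : E →L[ℂ] E} (hQ : Commute Q T) :
    IsDampedSolution T α (fun t => Q (w t)) (fun t => Q (v t)) := by
  intro t ht
  have hQ' : Q (T (w t)) = T (Q (w t)) := DFunLike.congr_fun hQ.eq (w t)
  refine ⟨(Q.restrictScalars ℝ).hasFDerivAt.comp_hasDerivAt t (h t ht).1, ?_⟩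
  refine ((Q.restrictScalars ℝ).hasFDerivAt.comp_hasDerivAt t (h t ht).2).congr_deriv ?_
  simp [hQ']

/-- A solution with `T w - μ w → 0` obeys the scalar equation `w'' + α w' + μ w = f` with `f → 0`,
which factors into two stable first-order equations. -/
lemma IsDampedSolution.tendsto_zero_of_sub_smul {T : E →L[ℂ] E} {α : ℝ} {w v : ℝ → E}
    (h : IsDampedSolution T α w v) (hα : 0 < α) {μ : ℂ} (hμ : μ.im ^ 2 < α ^ 2 * μ.re)
    (hw : Tendsto (fun t => T (w t) - μ • w t) atTop (𝓝 0)) : Tendsto w atTop (𝓝 0) := by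
  obtain ⟨l, m, hlm, hmul, hl, hm⟩ := exists_stable_roots hα hμ
  have h1 : Tendsto (fun t => v t - m • w t) atTop (𝓝 0) := by
    refine tendsto_zero_of_hasDerivAt_smul_add hl (f := fun t => -(T (w t) - μ • w t)) ?_
      (by simpa using hw.neg)
    intro t ht
    refine ((h t ht).2.sub ((h t ht).1.const_smul m)).congr_deriv ?_
    rw [← hlm, ← hmul]
    module
  refine tendsto_zero_of_hasDerivAt_smul_add hm (f := fun t => v t - m • w t) ?_ h1
  intro t ht
  refine (h t ht).1.congr_deriv ?_
  module

/-- The roots of a polynomial are peeled off one at a time: if `q(T) w → 0` and all roots of `q`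
are damped, then `w → 0`. -/
lemma IsDampedSolution.tendsto_zero_of_aeval {T : E →L[ℂ] E} {α : ℝ} (hα : 0 < α)
    (s : Multiset ℂ) (hs : ∀ μ ∈ s, μ.im ^ 2 < α ^ 2 * μ.re) {w v : ℝ → E}
    (h : IsDampedSolution T α w v)
    (hw : Tendsto (fun t => Polynomial.aeval T
      (s.map fun μ => Polynomial.X - Polynomial.C μ).prod (w t)) atTop (𝓝 0)) :
    Tendsto w atTop (𝓝 0) := by
  induction s using Multiset.induction_on generalizing w v with
  | empty => simpa using hw
  | cons μ s ih =>
    refine h.tendsto_zero_of_sub_smul hα (hs μ (Multiset.mem_cons_self _ _)) ?_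
    have hc : Commute (T - algebraMap ℂ (E →L[ℂ] E) μ) T :=
      (Commute.refl T).sub_left (Algebra.commutes μ T)
    have := ih (fun ν hν => hs ν (Multiset.mem_cons_of_mem hν)) (h.map hc) (by
      refine hw.congr fun t => ?_
      rw [Multiset.map_cons, Multiset.prod_cons, mul_comm, map_mul]
      simp)
    simpa [Algebra.algebraMap_eq_smul_one] using this

end Decay

/-! ### Definite matrices -/

section Definite

variable {d : ℕ} {A : Matrix (Fin d) (Fin d) ℝ}

lemma IsPosDef.isUnit_det (hA : IsPosDef A) : IsUnit A.det := by
  rw [isUnit_iff_ne_zero]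
  intro h
  obtain ⟨x, hx, hAx⟩ := Matrix.exists_mulVec_eq_zero_iff.2 h
  have := hA x hx
  simp [hAx] at this

lemma IsNegDef.neg (hA : IsNegDef A) : IsPosDef (-A) := fun x hx => by
  simpa [Matrix.neg_mulVec] using hA x hx

lemma isUnit_det_of_definite (hA : IsPosDef A ∨ IsNegDef A) : IsUnit A.det := by
  rcases hA with hA | hA
  · exact hA.isUnit_det
  · simpa [Matrix.det_neg, IsUnit.mul_iff] using hA.neg.isUnit_det

lemma IsPosDef.inv (hA : IsPosDef A) : IsPosDef A⁻¹ := by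
  intro x hx
  have hu := hA.isUnit_det
  have hAx : A *ᵥ (A⁻¹ *ᵥ x) = x := by simp [Matrix.mulVec_mulVec, Matrix.mul_nonsing_inv A hu]
  have hne : A⁻¹ *ᵥ x ≠ 0 := by
    intro h
    rw [h, Matrix.mulVec_zero] at hAx
    exact hx hAx.symm
  have h := hA _ hne
  rwa [hAx, dotProduct_comm] at h

lemma matSign_mul_self (hA : IsPosDef A ∨ IsNegDef A) : matSign A * matSign A = 1 := by
  unfold matSign
  split_ifs with h1 h2
  · simp
  · simp
  · tauto

lemma isPosDef_matAbs (hA : IsPosDef A ∨ IsNegDef A) : IsPosDef (matAbs A) := by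
  unfold matAbs matSign
  split_ifs with h1 h2
  · simpa using h1
  · simpa using h2.neg
  · tauto

lemma matAbs_inv (hA : IsPosDef A ∨ IsNegDef A) : matAbs A⁻¹ = matSign A • A⁻¹ := by
  have hu := isUnit_det_of_definite hA
  have hpos : IsPosDef A⁻¹ ↔ IsPosDef A :=
    ⟨fun h => by simpa [Matrix.nonsing_inv_nonsing_inv A hu] using h.inv, IsPosDef.inv⟩
  -- For `d = 0` every matrix is both positive and negative definite, hence the case hypothesis.
  have hneg : ¬ IsPosDef A → IsNegDef A⁻¹ := by
    intro h x hx
    have h1 := (hA.resolve_left h).neg.inv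
    have h2 : (-A)⁻¹ = -A⁻¹ := by
      apply Matrix.inv_eq_left_inv
      simp [Matrix.nonsing_inv_mul A hu]
    rw [h2] at h1
    simpa [Matrix.neg_mulVec] using h1 x hx
  unfold matAbs matSign
  by_cases h : IsPosDef A
  · simp [h, h.inv]
  · simp [h, hpos, hneg h, hA.resolve_left h]

lemma isPosDef_sum {n : ℕ} (hn : Nonempty (Fin n)) {M : Fin n → Matrix (Fin d) (Fin d) ℝ}
    (hM : ∀ i, IsPosDef (M i)) : IsPosDef (∑ i, M i) := by
  intro x hx
  rw [Matrix.sum_mulVec, dotProduct_sum]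
  exact Finset.sum_pos (fun i _ => hM i x hx) Finset.univ_nonempty

end Definite

/-! ### The scaled Laplacian -/

section ScaledLaplacian

variable {n d : ℕ}

lemma blkdiag_mulVec_apply (M : Fin n → Matrix (Fin d) (Fin d) ℝ) (v : Fin n × Fin d → ℝ)
    (i : Fin n) (k : Fin d) : (blkdiag M *ᵥ v) (i, k) = (M i *ᵥ fun l => v (i, l)) k := by
  simp [Matrix.mulVec, dotProduct, blkdiag, Fintype.sum_prod_type, ite_mul]

lemma kronecker_one_mulVec_apply (L : Matrix (Fin n) (Fin n) ℝ) (v : Fin n × Fin d → ℝ)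
    (i : Fin n) (k : Fin d) :
    ((L ⊗ₖ (1 : Matrix (Fin d) (Fin d) ℝ)) *ᵥ v) (i, k) = (L *ᵥ fun j => v (j, k)) i := by
  simp [Matrix.mulVec, dotProduct, Fintype.sum_prod_type, Matrix.one_apply, ite_mul, mul_ite]

lemma dotProduct_blkdiag_pos {M : Fin n → Matrix (Fin d) (Fin d) ℝ} (hM : ∀ i, IsPosDef (M i))
    {v : Fin n × Fin d → ℝ} (hv : v ≠ 0) : 0 < v ⬝ᵥ (blkdiag M *ᵥ v) := by
  have hsum : v ⬝ᵥ (blkdiag M *ᵥ v)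
      = ∑ i, (fun l => v (i, l)) ⬝ᵥ (M i *ᵥ fun l => v (i, l)) := by
    simp only [dotProduct, Fintype.sum_prod_type, blkdiag_mulVec_apply]
  rw [hsum]
  obtain ⟨⟨i, k⟩, hik⟩ := Function.ne_iff.1 hv
  refine Finset.sum_pos' (fun j _ => ?_) ⟨i, Finset.mem_univ _, hM i _ ?_⟩
  · by_cases h : (fun l => v (j, l)) = 0
    · simp [h]
    · exact (hM j _ h).le
  · exact Function.ne_iff.2 ⟨k, hik⟩

lemma blkdiag_mulVec_eq_zero {M : Fin n → Matrix (Fin d) (Fin d) ℝ} (hM : ∀ i, IsPosDef (M i))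
    {v : Fin n × Fin d → ℝ} (hv : blkdiag M *ᵥ v = 0) : v = 0 := by
  by_contra h
  have := dotProduct_blkdiag_pos hM h
  simp [hv] at this

variable (G : SimpleGraph (Fin n)) [DecidableRel G.Adj] {S : Fin n → Matrix (Fin d) (Fin d) ℝ}

lemma scaledLaplacian_mulVec_apply (y : Fin n → Fin d → ℝ) (i : Fin n) (k : Fin d) :
    (scaledLaplacian G S *ᵥ fun p => y p.1 p.2) (i, k)
      = (matAbs (S i) *ᵥ ∑ j ∈ G.neighborFinset i, (y i - y j)) k := by
  rw [scaledLaplacian, ← Matrix.mulVec_mulVec, blkdiag_mulVec_apply]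
  congr 2
  ext l
  rw [kronecker_one_mulVec_apply, SimpleGraph.lapMatrix_mulVec_apply]
  simp [Finset.sum_apply]

variable {G}

/-- The kernel of `Θ` consists of the consensus vectors. -/
lemma eq_of_scaledLaplacian_mulVec_eq_zero (hG : G.Connected)
    (hS : ∀ i, IsPosDef (S i) ∨ IsNegDef (S i)) {v : Fin n × Fin d → ℝ}
    (hv : scaledLaplacian G S *ᵥ v = 0) (i j : Fin n) (k : Fin d) : v (i, k) = v (j, k) := by
  rw [scaledLaplacian, ← Matrix.mulVec_mulVec] at hv
  have h := blkdiag_mulVec_eq_zero (fun i => isPosDef_matAbs (hS i)) hv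
  refine (G.lapMatrix_mulVec_eq_zero_iff_forall_reachable (x := fun j => v (j, k))).1 ?_ i j
    (hG.preconnected i j)
  ext a
  rw [← kronecker_one_mulVec_apply, h]
  rfl

/-- The eigenvalue `0` of `Θ` is semisimple: if `K D K v = 0` with `K` symmetric and `D` positive
definite, then `(K v) ⬝ D (K v) = 0` and hence `K v = 0`. -/
lemma scaledLaplacian_mulVec_eq_zero_of_sq (hS : ∀ i, IsPosDef (S i) ∨ IsNegDef (S i))
    {v : Fin n × Fin d → ℝ}
    (hv : scaledLaplacian G S *ᵥ (scaledLaplacian G S *ᵥ v) = 0) :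
    scaledLaplacian G S *ᵥ v = 0 := by
  have hpos : ∀ i, IsPosDef (matAbs (S i)) := fun i => isPosDef_matAbs (hS i)
  set K := G.lapMatrix ℝ ⊗ₖ (1 : Matrix (Fin d) (Fin d) ℝ) with hK
  have hsymm : Kᵀ = K := by
    rw [hK, ← Matrix.kroneckerMap_transpose, (G.isSymm_lapMatrix ℝ).eq, Matrix.transpose_one]
  simp only [scaledLaplacian, ← hK, ← Matrix.mulVec_mulVec] at hv ⊢
  have h1 := blkdiag_mulVec_eq_zero hpos hv
  have h2 : (K *ᵥ v) ⬝ᵥ (blkdiag (fun i => matAbs (S i)) *ᵥ (K *ᵥ v)) = 0 := by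
    have h3 : K *ᵥ v = v ᵥ* K := by rw [← Matrix.mulVec_transpose, hsymm]
    nth_rewrite 1 [h3]
    rw [← Matrix.dotProduct_mulVec, h1, dotProduct_zero]
  have h4 : K *ᵥ v = 0 := by
    by_contra h
    exact (dotProduct_blkdiag_pos hpos h).ne' h2
  rw [h4, Matrix.mulVec_zero]

/-- Semisimplicity of the eigenvalue `0` in polynomial form: `Θ q(Θ) = 0`, where `q` is the
characteristic polynomial of `Θ` with its factors `X` removed. -/
lemma exists_annihilating_polynomial (hS : ∀ i, IsPosDef (S i) ∨ IsNegDef (S i)) :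
    ∃ q : Polynomial ℝ, q.Monic ∧ q ∣ (scaledLaplacian G S).charpoly ∧ q.eval 0 ≠ 0 ∧
      Polynomial.aeval (scaledLaplacian G S) q * scaledLaplacian G S = 0 := by
  set Θ := scaledLaplacian G S
  obtain ⟨q, hq, hndvd⟩ := Polynomial.exists_eq_pow_rootMultiplicity_mul_and_not_dvd
    Θ.charpoly Θ.charpoly_monic.ne_zero 0
  have hmonic : q.Monic := by
    refine Polynomial.Monic.of_mul_monic_left
      (p := (Polynomial.X - Polynomial.C 0) ^ Polynomial.rootMultiplicity 0 Θ.charpoly)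
      ((Polynomial.monic_X_sub_C 0).pow _) ?_
    rw [← hq]
    exact Θ.charpoly_monic
  refine ⟨q, hmonic, ⟨_, hq.trans (mul_comm _ _)⟩, fun h => hndvd (Polynomial.dvd_iff_isRoot.2 h), ?_⟩
  have hsq : ∀ (k : ℕ) (v : Fin n × Fin d → ℝ), Θ ^ k *ᵥ v = 0 → Θ *ᵥ v = 0 := by
    intro k
    induction k with
    | zero => intro v hv; simp_all
    | succ k ih =>
      intro v hv
      rw [pow_succ, ← Matrix.mulVec_mulVec] at hv
      exact scaledLaplacian_mulVec_eq_zero_of_sq hS (ih _ hv)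
  have h0 : Θ ^ (Polynomial.rootMultiplicity 0 Θ.charpoly) * Polynomial.aeval Θ q = 0 := by
    have := Θ.aeval_self_charpoly
    rw [hq] at this
    simpa using this
  have hcomm : Polynomial.aeval Θ q * Θ = Θ * Polynomial.aeval Θ q := by
    simpa using (Polynomial.commute_X q).map (Polynomial.aeval Θ) |>.eq.symm
  rw [hcomm, Matrix.ext_iff_mulVec]
  intro v
  rw [← Matrix.mulVec_mulVec, Matrix.zero_mulVec]
  refine hsq (Polynomial.rootMultiplicity 0 Θ.charpoly) _ ?_
  rw [Matrix.mulVec_mulVec, h0, Matrix.zero_mulVec]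

lemma mem_nonzeroEigenvalues_iff {μ : ℂ} : μ ∈ nonzeroEigenvalues G S ↔
    ((scaledLaplacian G S).charpoly.map (algebraMap ℝ ℂ)).IsRoot μ ∧ μ ≠ 0 := by
  rw [nonzeroEigenvalues, mem_ofPred_eq, Matrix.mem_spectrum_iff_isRoot_charpoly]
  rw [← Matrix.charpoly_map]
  rfl

/-- Since `Θ` is real, its nonzero eigenvalues are closed under conjugation, so the largest
imaginary part bounds `|Im μ|` and the damping condition yields `α² Re μ > (Im μ)²`. -/
lemma DampingCondition.im_sq_lt {α : ℝ} (hα : 0 < α) (h : DampingCondition G S α) {μ : ℂ}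
    (hμ : μ ∈ nonzeroEigenvalues G S) : μ.im ^ 2 < α ^ 2 * μ.re := by
  have hfin : (nonzeroEigenvalues G S).Finite := by
    refine ((((scaledLaplacian G S).charpoly_monic.map (algebraMap ℝ ℂ)).ne_zero |>
      Polynomial.finite_setOfPred_isRoot)).subset fun ν hν => ?_
    exact (mem_nonzeroEigenvalues_iff.1 hν).1
  have hconj : (starRingEnd ℂ) μ ∈ nonzeroEigenvalues G S := by
    rw [mem_nonzeroEigenvalues_iff] at hμ ⊢
    refine ⟨?_, by simpa using hμ.2⟩
    have h1 := congrArg (starRingEnd ℂ) hμ.1.eq_zero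
    rw [map_zero, Polynomial.eval_map_algebraMap] at h1
    rw [Polynomial.IsRoot, Polynomial.eval_map_algebraMap, Polynomial.aeval_conj, h1]
  obtain ⟨a, ha, hmin⟩ := exists_min_image _ Complex.re hfin ⟨μ, hμ⟩
  obtain ⟨b, hb, hmax⟩ := exists_max_image _ Complex.im hfin ⟨μ, hμ⟩
  have h1 := h a.re b.im ⟨mem_image_of_mem _ ha, forall_mem_image.2 hmin⟩
    ⟨mem_image_of_mem _ hb, forall_mem_image.2 hmax⟩
  have h2 := hmin μ hμ
  have h3 := hmax μ hμ
  have h4 : -μ.im ≤ b.im := by simpa using hmax _ hconj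
  have h5 : μ.im ^ 2 ≤ b.im ^ 2 := sq_le_sq' (by linarith) h3
  rw [div_lt_iff₀ (by positivity)] at h1
  have h6 := mul_le_mul_of_nonneg_left h2 (sq_nonneg α)
  linarith

end ScaledLaplacian

/-! ### Convergence of the trajectories -/

section Convergence

variable {n d : ℕ} {G : SimpleGraph (Fin n)} [DecidableRel G.Adj]
  {S : Fin n → Matrix (Fin d) (Fin d) ℝ}

/-- Every real solution of `y'' + α y' + Θ y = 0` satisfies `Θ y → 0` and `y' → 0`. After
complexification, `Θ y` is a solution annihilated by `q(Θ)`, where `q` has damped roots only; then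
`y'' + α y' = -Θ y → 0` forces `y' → 0`. -/
lemma tendsto_scaledLaplacian_mulVec_and_deriv
    (hS : ∀ i, IsPosDef (S i) ∨ IsNegDef (S i)) {α : ℝ} (hα : 0 < α)
    (hcond : DampingCondition G S α) {y v : ℝ → Fin n × Fin d → ℝ}
    (hy : ∀ t, 0 < t → HasDerivAt y (v t) t)
    (hv : ∀ t, 0 < t → HasDerivAt v (-α • v t - scaledLaplacian G S *ᵥ y t) t) :
    Tendsto (fun t => scaledLaplacian G S *ᵥ y t) atTop (𝓝 0) ∧ Tendsto v atTop (𝓝 0) := by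
  set Θ := scaledLaplacian G S
  let φ : Matrix (Fin n × Fin d) (Fin n × Fin d) ℂ →ₐ[ℂ]
      ((Fin n × Fin d → ℂ) →L[ℂ] (Fin n × Fin d → ℂ)) :=
    (Matrix.toLinAlgEquiv'.trans (Module.End.toContinuousLinearMap (Fin n × Fin d → ℂ))).toAlgHom
  have hφ : ∀ (A : Matrix (Fin n × Fin d) (Fin n × Fin d) ℂ) u, φ A u = A *ᵥ u := fun _ _ => rfl
  let c : (Fin n × Fin d → ℝ) → Fin n × Fin d → ℂ := fun u p => (u p : ℂ)
  have hc : ∀ (A : Matrix (Fin n × Fin d) (Fin n × Fin d) ℝ) u,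
      φ ((algebraMap ℝ ℂ).mapMatrix A) (c u) = c (A *ᵥ u) := by
    intro A u
    rw [hφ]
    ext p
    exact ((algebraMap ℝ ℂ).map_mulVec A u p).symm
  have hc_tendsto : ∀ u : ℝ → Fin n × Fin d → ℝ,
      Tendsto (fun t => c (u t)) atTop (𝓝 0) → Tendsto u atTop (𝓝 0) := by
    intro u hu
    rw [tendsto_pi_nhds] at hu ⊢
    intro p
    simpa [c, Function.comp_def] using (Complex.continuous_re.tendsto _).comp (hu p)
  have hc_deriv : ∀ (u : ℝ → Fin n × Fin d → ℝ) u' t, HasDerivAt u u' t →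
      HasDerivAt (fun s => c (u s)) (c u') t := by
    intro u u' t hu
    rw [hasDerivAt_pi] at hu ⊢
    exact fun p => (hu p).ofReal_comp
  set T := φ ((algebraMap ℝ ℂ).mapMatrix Θ) with hT
  have hsol : IsDampedSolution T α (fun t => c (y t)) (fun t => c (v t)) := by
    intro t ht
    refine ⟨hc_deriv _ _ _ (hy t ht), (hc_deriv _ _ _ (hv t ht)).congr_deriv ?_⟩
    rw [hT, hc]
    ext p
    simp [c]
  have hTy : Tendsto (fun t => T (c (y t))) atTop (𝓝 0) := by
    obtain ⟨q, hmonic, hdvd, h0, hq⟩ := exists_annihilating_polynomial (G := G) hS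
    set Q := q.map (algebraMap ℝ ℂ) with hQ
    have hQmonic : Q.Monic := hmonic.map _
    refine (hsol.map (Commute.refl T)).tendsto_zero_of_aeval hα Q.roots ?_ ?_
    · intro μ hμ
      have hroot := (Polynomial.mem_roots hQmonic.ne_zero).1 hμ
      refine hcond.im_sq_lt hα (mem_nonzeroEigenvalues_iff.2
        ⟨hroot.dvd (Polynomial.map_dvd _ hdvd), ?_⟩)
      rintro rfl
      apply h0
      have h1 : Polynomial.eval (algebraMap ℝ ℂ 0) Q = 0 := by
        rw [map_zero]
        exact hroot
      rw [hQ, Polynomial.eval_map_apply] at h1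
      exact (map_eq_zero (algebraMap ℝ ℂ)).1 h1
    · rw [← (IsAlgClosed.splits Q).eq_prod_roots_of_monic hQmonic]
      refine tendsto_const_nhds.congr fun t => ?_
      have h1 : Polynomial.aeval T Q = φ ((algebraMap ℝ ℂ).mapMatrix (Polynomial.aeval Θ q)) := by
        rw [hT, Polynomial.aeval_algHom_apply]
        congr 1
        refine (Polynomial.map_aeval_eq_aeval_map (φ := algebraMap ℝ ℂ)
          (ψ := (algebraMap ℝ ℂ).mapMatrix) ?_ q Θ).symm
        ext r i j
        by_cases hij : i = j <;> simp [Matrix.algebraMap_matrix_apply, hij]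
      rw [h1, hT, hc, hc, Matrix.mulVec_mulVec, hq, Matrix.zero_mulVec]
      ext p
      simp [c]
  have hvc : Tendsto (fun t => c (v t)) atTop (𝓝 0) := by
    refine tendsto_zero_of_hasDerivAt_smul_add (l := -(α : ℂ)) (by simpa using hα)
      (f := fun t => -T (c (y t))) ?_ (by simpa using hTy.neg)
    intro t ht
    simpa [sub_eq_add_neg] using (hsol t ht).2
  refine ⟨hc_tendsto _ (hTy.congr fun t => ?_), hc_tendsto _ hvc⟩
  rw [hT, hc]

/-- A linear functional vanishing on `ker f` factors through `f`, so it tends to zero along any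
family along which `f` does. -/
lemma tendsto_zero_of_ker_le {ι V W : Type*} {l : Filter ι} [AddCommGroup V] [Module ℝ V]
    [NormedAddCommGroup W] [NormedSpace ℝ W] [FiniteDimensional ℝ W] {f : V →ₗ[ℝ] W}
    {φ : V →ₗ[ℝ] ℝ} (h : LinearMap.ker f ≤ LinearMap.ker φ) {y : ι → V}
    (hy : Tendsto (fun t => f (y t)) l (𝓝 0)) : Tendsto (fun t => φ (y t)) l (𝓝 0) := by
  obtain ⟨ψ, rfl⟩ : φ ∈ LinearMap.range f.dualMap := by
    rw [LinearMap.range_dualMap_eq_dualAnnihilator_ker, Submodule.mem_dualAnnihilator]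
    exact fun w hw => h hw
  simpa [Function.comp_def] using (ψ.continuous_of_finiteDimensional.tendsto 0).comp hy

variable {α : ℝ} {x1 x2 : ℝ → Fin n → Fin d → ℝ}

lemma hasDerivAt_mulVec {m k : ℕ} (A : Matrix (Fin m) (Fin k) ℝ) {u : ℝ → Fin k → ℝ}
    {u' : Fin k → ℝ} {t : ℝ} (hu : HasDerivAt u u' t) :
    HasDerivAt (fun s => A *ᵥ u s) (A *ᵥ u') t :=
  (LinearMap.toContinuousLinearMap A.mulVecLin).hasFDerivAt.comp_hasDerivAt t hu

lemma tendsto_mulVec {ι : Type*} {l : Filter ι} {m k : ℕ} (A : Matrix (Fin m) (Fin k) ℝ)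
    {u : ι → Fin k → ℝ} {a : Fin k → ℝ} (hu : Tendsto u l (𝓝 a)) :
    Tendsto (fun t => A *ᵥ u t) l (𝓝 (A *ᵥ a)) :=
  ((Continuous.matrix_mulVec continuous_const continuous_id).tendsto a).comp hu

/-- In the scaled coordinates `y i = S i x_i¹` a trajectory solves `y'' + α y' + Θ y = 0`. -/
lemma IsTrajectory.tendsto_scaled (hx : IsTrajectory G S α x1 x2)
    (hS : ∀ i, IsPosDef (S i) ∨ IsNegDef (S i)) (hα : 0 < α) (hcond : DampingCondition G S α) :
    Tendsto (fun t => scaledLaplacian G S *ᵥ fun p => (S p.1 *ᵥ x1 t p.1) p.2) atTop (𝓝 0) ∧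
      ∀ i, Tendsto (fun t => S i *ᵥ x2 t i) atTop (𝓝 0) := by
  have hder : ∀ i t, 0 < t → HasDerivAt (fun s => x1 s i) (x2 t i) t ∧
      HasDerivAt (fun s => x2 s i) (consensusLaw G S α (x1 t) (x2 t) i) t := fun i t ht =>
    ⟨(hx i t ht.le).1.hasDerivAt (Ici_mem_nhds ht), (hx i t ht.le).2.hasDerivAt (Ici_mem_nhds ht)⟩
  have h := tendsto_scaledLaplacian_mulVec_and_deriv hS hα hcond
    (y := fun t p => (S p.1 *ᵥ x1 t p.1) p.2) (v := fun t p => (S p.1 *ᵥ x2 t p.1) p.2) ?_ ?_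
  · refine ⟨h.1, fun i => tendsto_pi_nhds.2 fun k => ?_⟩
    exact tendsto_pi_nhds.1 h.2 (i, k)
  · intro t ht
    rw [hasDerivAt_pi]
    rintro ⟨i, k⟩
    exact hasDerivAt_pi.1 (hasDerivAt_mulVec (S i) (hder i t ht).1) k
  · intro t ht
    rw [hasDerivAt_pi]
    rintro ⟨i, k⟩
    refine (hasDerivAt_pi.1 (hasDerivAt_mulVec (S i) (hder i t ht).2) k).congr_deriv ?_
    rw [Pi.sub_apply, scaledLaplacian_mulVec_apply G (fun i => S i *ᵥ x1 t i)]
    simp only [consensusLaw, matAbs, Matrix.mulVec_sub, Matrix.mulVec_neg, Matrix.mulVec_smul,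
      Matrix.smul_mulVec, Pi.sub_apply, Pi.neg_apply, Pi.smul_apply, smul_eq_mul]
    ring

/-- The network forces cancel in `∑ sign(S_i) (α x_i¹ + x_i²)`, which is therefore conserved. -/
lemma IsTrajectory.sum_matSign_smul_eq (hx : IsTrajectory G S α x1 x2)
    (hS : ∀ i, IsPosDef (S i) ∨ IsNegDef (S i)) {t : ℝ} (ht : 0 ≤ t) :
    ∑ i, matSign (S i) • (α • x1 t i + x2 t i) = ∑ i, matSign (S i) • (α • x1 0 i + x2 0 i) := by
  have hd : ∀ s, 0 ≤ s → HasDerivWithinAt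
      (fun s => ∑ i, matSign (S i) • (α • x1 s i + x2 s i)) 0 (Ici 0) s := by
    intro s hs
    refine (HasDerivWithinAt.fun_sum fun i _ =>
      ((((hx i s hs).1.const_smul α).add (hx i s hs).2).const_smul (matSign (S i)))).congr_deriv ?_
    have h1 : ∀ i, matSign (S i) • (α • x2 s i + consensusLaw G S α (x1 s) (x2 s) i)
        = -∑ j ∈ G.neighborFinset i, (S i *ᵥ x1 s i - S j *ᵥ x1 s j) := by
      intro i
      rw [consensusLaw, add_sub_cancel, smul_neg, smul_smul, matSign_mul_self (hS i), one_smul]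
    simp only [h1, Finset.sum_neg_distrib, neg_eq_zero]
    simp only [SimpleGraph.neighborFinset_eq_filter, Finset.sum_filter]
    -- Swapping the two endpoints of every edge shows that the sum equals its own negative.
    rw [← self_eq_neg]
    conv_rhs => rw [Finset.sum_comm]
    simp only [← Finset.sum_neg_distrib]
    refine Finset.sum_congr rfl fun i _ => Finset.sum_congr rfl fun j _ => ?_
    simp only [G.adj_comm j i]
    split_ifs <;> simp
  refine constant_of_has_deriv_right_zero (a := 0) (b := t)
    (f := fun s => ∑ i, matSign (S i) • (α • x1 s i + x2 s i)) ?_ ?_ t (right_mem_Icc.2 ht)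
  · exact fun s hs => (hd s hs.1).continuousWithinAt.mono Icc_subset_Ici_self
  · exact fun s hs => (hd s hs.1).mono (Ici_subset_Ici.2 hs.1)

/-- The scaled positions synchronize, so weighting them by `S_i⁻¹` and comparing with the conserved
quantity determines their common limit. -/
lemma IsTrajectory.tendsto_mulVec_virtualPoint (hx : IsTrajectory G S α x1 x2)
    (hG : G.Connected) (hS : ∀ i, IsPosDef (S i) ∨ IsNegDef (S i)) (hα : 0 < α)
    (hcond : DampingCondition G S α) (hx2 : ∀ i, Tendsto (fun t => x2 t i) atTop (𝓝 0))
    (i : Fin n) :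
    Tendsto (fun t => S i *ᵥ x1 t i) atTop
      (𝓝 (virtualPoint S (x1 0) + α⁻¹ • virtualPoint S (x2 0))) := by
  have hsync : ∀ j, Tendsto (fun t => S i *ᵥ x1 t i - S j *ᵥ x1 t j) atTop (𝓝 0) := by
    intro j
    refine tendsto_pi_nhds.2 fun k => ?_
    let π : Fin n × Fin d → (Fin n × Fin d → ℝ) →ₗ[ℝ] ℝ := LinearMap.proj
    refine tendsto_zero_of_ker_le (f := (scaledLaplacian G S).mulVecLin)
      (φ := π (i, k) - π (j, k)) ?_
      (y := fun t p => (S p.1 *ᵥ x1 t p.1) p.2) (hx.tendsto_scaled hS hα hcond).1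
    intro v hv
    have := eq_of_scaledLaplacian_mulVec_eq_zero hG hS hv i j k
    simp [π, this]
  set R := ∑ j, matAbs (S j)⁻¹ with hR
  have hRu : IsUnit R.det := by
    refine (isPosDef_sum ⟨i⟩ fun j => ?_).isUnit_det
    have h1 : matAbs (S j)⁻¹ = (matAbs (S j))⁻¹ := by
      rw [matAbs_inv (hS j)]
      refine (Matrix.inv_eq_left_inv ?_).symm
      rw [matAbs, Matrix.smul_mul, Matrix.mul_smul, smul_smul, matSign_mul_self (hS j), one_smul,
        Matrix.nonsing_inv_mul _ (isUnit_det_of_definite (hS j))]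
    rw [h1]
    exact (isPosDef_matAbs (hS j)).inv
  -- `R y_i = ∑ |S_j⁻¹| (y_i - y_j) + ∑ sign(S_j) x_j¹`, and the second sum is controlled by the
  -- conserved quantity.
  have hdecomp : ∀ t, 0 ≤ t → R *ᵥ (S i *ᵥ x1 t i)
      = ∑ j, matAbs (S j)⁻¹ *ᵥ (S i *ᵥ x1 t i - S j *ᵥ x1 t j)
        + α⁻¹ • (∑ j, matSign (S j) • (α • x1 0 j + x2 0 j) - ∑ j, matSign (S j) • x2 t j) := by
    intro t ht
    rw [← hx.sum_matSign_smul_eq hS ht, ← Finset.sum_sub_distrib, Finset.smul_sum,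
      ← Finset.sum_add_distrib, hR, Matrix.sum_mulVec]
    refine Finset.sum_congr rfl fun j _ => ?_
    have h1 : matAbs (S j)⁻¹ *ᵥ (S j *ᵥ x1 t j) = matSign (S j) • x1 t j := by
      rw [matAbs_inv (hS j), Matrix.smul_mulVec, Matrix.mulVec_mulVec,
        Matrix.nonsing_inv_mul _ (isUnit_det_of_definite (hS j)), Matrix.one_mulVec]
    rw [Matrix.mulVec_sub, h1, ← smul_sub, add_sub_cancel_right, smul_comm α⁻¹, smul_smul α⁻¹,
      inv_mul_cancel₀ hα.ne', one_smul, sub_add_cancel]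
  have hlim : Tendsto (fun t => R *ᵥ (S i *ᵥ x1 t i)) atTop
      (𝓝 (α⁻¹ • ∑ j, matSign (S j) • (α • x1 0 j + x2 0 j))) := by
    have h1 : Tendsto (fun t => ∑ j, matAbs (S j)⁻¹ *ᵥ (S i *ᵥ x1 t i - S j *ᵥ x1 t j)) atTop
        (𝓝 0) := by
      simpa using tendsto_finsetSum Finset.univ
        fun j _ => tendsto_mulVec (matAbs (S j)⁻¹) (hsync j)
    have h2 : Tendsto (fun t => ∑ j, matSign (S j) • x2 t j) atTop (𝓝 0) := by
      simpa using tendsto_finsetSum Finset.univ fun j _ => (hx2 j).const_smul (matSign (S j))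
    have h3 := h1.add ((h2.const_sub (∑ j, matSign (S j) • (α • x1 0 j + x2 0 j))).const_smul α⁻¹)
    rw [zero_add, sub_zero] at h3
    refine h3.congr' ?_
    filter_upwards [eventually_ge_atTop 0] with t ht using (hdecomp t ht).symm
  have hval : R⁻¹ *ᵥ (α⁻¹ • ∑ j, matSign (S j) • (α • x1 0 j + x2 0 j))
      = virtualPoint S (x1 0) + α⁻¹ • virtualPoint S (x2 0) := by
    rw [virtualPoint, virtualPoint, ← hR, ← Matrix.mulVec_smul, ← Matrix.mulVec_add]
    congr 1
    rw [Finset.smul_sum, Finset.smul_sum, ← Finset.sum_add_distrib]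
    refine Finset.sum_congr rfl fun j _ => ?_
    rw [smul_add, smul_add, smul_comm α⁻¹, smul_smul α⁻¹, inv_mul_cancel₀ hα.ne', one_smul]
  rw [← hval]
  refine (tendsto_mulVec R⁻¹ hlim).congr fun t => ?_
  rw [Matrix.mulVec_mulVec, Matrix.nonsing_inv_mul _ hRu, Matrix.one_mulVec]

end Convergence

end MSC

theorem mainTheorem2 {n d : ℕ} (G : SimpleGraph (Fin n)) [DecidableRel G.Adj]
    (hG : G.Connected) (S : Fin n → Matrix (Fin d) (Fin d) ℝ)
    (hS : ∀ i, MSC.IsPosDef (S i) ∨ MSC.IsNegDef (S i))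
    (α : ℝ) (hα : 0 < α) (hcond : MSC.DampingCondition G S α)
    (x1 x2 : ℝ → Fin n → Fin d → ℝ) (hx : MSC.IsTrajectory G S α x1 x2) :
    (∃ p ∈ MSC.consensusSet S, Tendsto (fun t => (x1 t, x2 t)) atTop (𝓝 p)) ∧
    (∀ i, Tendsto (fun t => S i *ᵥ x1 t i) atTop
      (𝓝 (MSC.virtualPoint S (x1 0) + α⁻¹ • MSC.virtualPoint S (x2 0)))) ∧
    (∀ i, Tendsto (fun t => x2 t i) atTop (𝓝 0)) := by
  have hinv : ∀ i (u : Fin d → ℝ), (S i)⁻¹ *ᵥ (S i *ᵥ u) = u := fun i u => by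
    rw [Matrix.mulVec_mulVec, Matrix.nonsing_inv_mul _ (MSC.isUnit_det_of_definite (hS i)),
      Matrix.one_mulVec]
  have hinv' : ∀ i (u : Fin d → ℝ), S i *ᵥ ((S i)⁻¹ *ᵥ u) = u := fun i u => by
    rw [Matrix.mulVec_mulVec, Matrix.mul_nonsing_inv _ (MSC.isUnit_det_of_definite (hS i)),
      Matrix.one_mulVec]
  have hx2 : ∀ i, Tendsto (fun t => x2 t i) atTop (𝓝 0) := fun i => by
    simpa [hinv] using MSC.tendsto_mulVec (S i)⁻¹ ((hx.tendsto_scaled hS hα hcond).2 i)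
  have hx1 := hx.tendsto_mulVec_virtualPoint hG hS hα hcond hx2
  refine ⟨⟨(fun i => (S i)⁻¹ *ᵥ (MSC.virtualPoint S (x1 0) + α⁻¹ • MSC.virtualPoint S (x2 0)), 0),
    ⟨fun i j => ?_, rfl⟩, ?_⟩, hx1, hx2⟩
  · rw [hinv', hinv']
  · refine Tendsto.prodMk_nhds (tendsto_pi_nhds.2 fun i => ?_) (tendsto_pi_nhds.2 hx2)
    simpa [hinv] using MSC.tendsto_mulVec (S i)⁻¹ (hx1 i)
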